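/- Let $G=(V,E)$ be a finite circle graph, given by an interval representation: intervals $I(j)=[l_j,r_j]\subseteq\mathbb{R}$ $(j\in V)$ whose $2|V|$ terminal points are mutually distinct, such that two vertices are adjacent if and only if their intervals intersect but neither contains the other. Let $H\ge 1$ be an integer. Order $V$ by $i\preceq j$ if and only if $i=j$ or $r_i\le l_j$. The height of a set $S\subseteq V$ is the maximum size of an antichain of $(V,\preceq)$ contained in $S$. Let $\Xi_H$ be the set of independent sets of $G$ of height at most $H$, and let $F_H$ be the $V\times\Xi_H$ matrix whose columns are the incidence vectors of the members of $\Xi_H$. The problem $\mathrm{P}_H$ is $$\min\{\mathbf 1^\top q \mid F_H q=\mathbf 1,\ q\in\{0,1\}^{\Xi_H}\}.$$ Let $\Gamma_H$ be the directed graph with vertices $(0\cdot 0)$ and $(i\cdot h)$ for $i\in V$, $1\le h\le H$, and with arc set $$A_H=\{((0\cdot 0),(i\cdot 1))\mid i\in V\}\cup\{((i\cdot h),(j\cdot (h+1)))\mid I(i)\supsetneq I(j),\ 1\le h\le H-1\}.$$ Write $x^{i\cdot h}_j$ for the coordinate of a vector $x$ indexed by $A_H$ at the arc $((i\cdot h),(j\cdot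 (h+1)))$. Let $P$ be the set of terminal points of the intervals, and for $p\in P$, $j\in V$ put $m_{pj}=1$ if $p\in I(j)$ and $m_{pj}=0$ otherwise. Let $V^\bullet=\{i\in V\mid I(i)\supsetneq I(j)\text{ for some }j\in V\}$. The problem $\mathrm{CG}_H$ is to minimize $c$ over $x\in\{0,1\}^{A_H}$ and $c\in\mathbb{Z}_{\ge 0}$ subject to $$\sum_{j\in V} m_{pj}\,x^{0\cdot 0}_j\le c\qquad(p\in P),$$ $$\sum_{j:\,((i\cdot h),(j\cdot(h+1)))\in A_H} m_{pj}\,x^{i\cdot h}_j\ \le\ \sum_{a\in A_H\text{ entering }(i\cdot h)} x_a\qquad(i\in V^\bullet,\ 1\le h\le H-1,\ p\in P),$$ $$\sum_{h=1}^{H}\ \sum_{a\in A_H\text{ entering }(j\cdot h)} x_a=1\qquad(j\in V).$$ The linear relaxation of $\mathrm{CG}_H$ is obtained by replacing the integrality conditions by $x\ge 0$, $c\ge 0$ $(x,c$ real$)$, and that of $\mathrm{P}_H$ by replacing $q\in\{0,1\}^{\Xi_H}$ by $q\ge 0$ $(q$ real$)$. **Theorem.** The linear relaxations of $\mathrm{CG}_H$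 and of $\mathrm{P}_H$ both have optimal solutions, and the optimal value of the linear relaxation of $\mathrm{CG}_H$ is equal to the optimal value of the linear relaxation of $\mathrm{P}_H$. -/

import Mathlib

open scoped Matrix

/-- An interval representation of a graph `G`: closed intervals `I(j) = [l_j, r_j]` on the real
line, all of whose terminal points are mutually distinct, such that two vertices are adjacent
exactly when their intervals partially overlap (they meet, and neither contains the other).
The finite graphs with such a representation are the circle graphs (overlap graphs). -/
structure IntervalRep {V : Type*} (G : SimpleGraph V) where
  left : V → ℝ
  right : V → ℝ
  left_le_right : ∀ j, left j ≤ right j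
  endpoints_distinct : Function.Injective (Sum.elim left right)
  adj_iff : ∀ i j, G.Adj i j ↔
    (Set.Icc (left i) (right i) ∩ Set.Icc (left j) (right j)).Nonempty ∧
      ¬ Set.Icc (left i) (right i) ⊆ Set.Icc (left j) (right j) ∧
      ¬ Set.Icc (left j) (right j) ⊆ Set.Icc (left i) (right i)

namespace IntervalRep

variable {V : Type*} {G : SimpleGraph V} (I : IntervalRep G)

/-- The interval `I(j) = [l_j, r_j]`. -/
def interval (j : V) : Set ℝ := Set.Icc (I.left j) (I.right j)

/-- The partial order `i ⪯ j` on the vertices: `i = j` or `r_i ≤ l_j`. -/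
def Prec (i j : V) : Prop := i = j ∨ I.right i ≤ I.left j

open Classical in
/-- The height of a vertex set: the maximum size of an antichain of `(V, ⪯)` contained in it. -/
noncomputable def height (S : Finset V) : ℕ :=
  (S.powerset.filter (fun T : Finset V => IsAntichain I.Prec (T : Set V))).sup Finset.card

/-- `Ξ_H`: the independent sets of `G` whose height is at most `H`. -/
def IndepOfHeight (H : ℕ) : Type _ :=
  {S : Finset V // G.IsIndepSet (S : Set V) ∧ I.height S ≤ H}

noncomputable instance [Fintype V] (H : ℕ) : Fintype (I.IndepOfHeight H) :=
  haveI : Finite (I.IndepOfHeight H) := Subtype.finite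
  Fintype.ofFinite _

open Classical in
/-- The 0-1 matrix `F_H`, whose columns are the incidence vectors of the members of `Ξ_H`. -/
noncomputable def indepMatrix (H : ℕ) : Matrix V (I.IndepOfHeight H) ℝ :=
  Matrix.of fun v S => if v ∈ S.1 then 1 else 0

/-- The set `P` of the terminal points of the intervals. -/
def endpoints : Set ℝ := Set.range I.left ∪ Set.range I.right

open Classical in
/-- The 0-1 matrix `M`: `m_{pi} = 1` if and only if the terminal point `p` lies in `I(i)`. -/
noncomputable def cliqueMatrix : Matrix I.endpoints V ℝ :=
  Matrix.of fun p i => if (p : ℝ) ∈ I.interval i then 1 else 0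

/-- `V^•`: the vertices whose interval properly contains the interval of another vertex. -/
def nonMinimal : Set V := {i | ∃ j, I.interval j ⊂ I.interval i}

/-- The vertices of `Γ_H`. The root `(0·0)` is `none`. The copy `(i·h)`, for `h = 1, …, H`, is
`some (i, k)` with `h = k + 1`. -/
abbrev LayerVertex (V : Type*) (H : ℕ) : Type _ := Option (V × Fin H)

/-- The layered digraph `Γ_H`: the root has an arc to every `(i·1)`, and `(i·h)` has an arc to
`(j·h+1)` whenever `I(i)` properly contains `I(j)`. There are no other arcs. -/
def layerDigraph (H : ℕ) : Digraph (LayerVertex V H) where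
  Adj
    | none, some (_, k) => (k : ℕ) = 0
    | some (i, h), some (j, k) => I.interval j ⊂ I.interval i ∧ (k : ℕ) = (h : ℕ) + 1
    | _, none => False

/-- The set `A_H` of the arcs of `Γ_H`, as pairs (tail, head). No arc enters the root, so that
every head is a copy `(j·h)` of a vertex `j`. -/
def LayerArc (H : ℕ) : Type _ :=
  {a : LayerVertex V H × (V × Fin H) // (I.layerDigraph H).Adj a.1 (some a.2)}

noncomputable instance [Fintype V] (H : ℕ) : Fintype (I.LayerArc H) :=
  haveI : Finite (I.LayerArc H) := Subtype.finite
  Fintype.ofFinite _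

/-- The tail of an arc of `Γ_H`. -/
def LayerArc.tail {I : IntervalRep G} {H : ℕ} (a : I.LayerArc H) : LayerVertex V H := a.1.1

/-- The head of an arc of `Γ_H`. -/
def LayerArc.head {I : IntervalRep G} {H : ℕ} (a : I.LayerArc H) : V × Fin H := a.1.2

open Classical in
/-- The arcs of `Γ_H` that enter the copy `v`. -/
noncomputable def inArcs [Fintype V] {H : ℕ} (v : V × Fin H) : Finset (I.LayerArc H) :=
  Finset.univ.filter (fun a => a.head = v)

open Classical in
/-- The arcs of `Γ_H` that leave the vertex `u`. -/
noncomputable def outArcs [Fintype V] {H : ℕ} (u : LayerVertex V H) : Finset (I.LayerArc H) :=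
  Finset.univ.filter (fun a => a.tail = u)

/-- The linear constraints of the integer program `CG_H`, whose variables are a vector `x` indexed
by the arcs of `Γ_H` (`x^{i·h}_j` is the entry at the arc from `(i·h)` to `(j·h+1)`) and a
number `c`. In `CG_H` itself, `x` is a 0-1 vector and `c` is a nonnegative integer. -/
structure CGConstraints [Fintype V] (H : ℕ) (x : I.LayerArc H → ℝ) (c : ℝ) : Prop where
  root_le : ∀ p : I.endpoints,
    ∑ a ∈ I.outArcs none, I.cliqueMatrix p a.head.1 * x a ≤ c
  copy_le : ∀ i ∈ I.nonMinimal, ∀ h : Fin H, (h : ℕ) + 1 < H → ∀ p : I.endpoints,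
    ∑ a ∈ I.outArcs (some (i, h)), I.cliqueMatrix p a.head.1 * x a ≤ ∑ a ∈ I.inArcs (i, h), x a
  cover : ∀ j : V, ∑ h : Fin H, ∑ a ∈ I.inArcs (j, h), x a = 1

/-- The objective values of the feasible solutions of the linear relaxation of `CG_H`
(minimize `c`), in which integrality is replaced by `x ≥ 0` and `c ≥ 0`. -/
def cgRelaxationValues [Fintype V] (H : ℕ) : Set ℝ :=
  {c | ∃ x : I.LayerArc H → ℝ, I.CGConstraints H x c ∧ 0 ≤ x ∧ 0 ≤ c}

/-- The objective values of the feasible solutions of the linear relaxation of `P_H`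
(minimize `1ᵀ q` subject to `F_H q = 1`), in which `q ∈ {0,1}^{Ξ_H}` is replaced by `q ≥ 0`. -/
def pRelaxationValues [Fintype V] (H : ℕ) : Set ℝ :=
  {t | ∃ q : I.IndepOfHeight H → ℝ, I.indepMatrix H *ᵥ q = 1 ∧ 0 ≤ q ∧ t = 1 ⬝ᵥ q}

end IntervalRep

/-! The two relaxations have the same set of feasible objective values, and this set has a least
element. An independent set `S` is a laminar family of intervals: any two members are disjoint or
nested. Joining each member to the smallest member that strictly contains it, or to the root, embeds
`S` in `Γ_H` as an arborescence. A member with `k` ancestors sits in layer `k + 1`, and height at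
most `H` means that at most `H` layers occur.

From `P_H` to `CG_H`, let `x a` be the total weight of the sets whose arborescence uses `a`. The
children of a node are pairwise disjoint, so a point lies in at most one of them, which gives the
point constraints (`cgConstraints_of_shallow`).

Conversely, `x` is decomposed by sweeping the vertices by left endpoint. When `j` is reached,
consider an arc `a` into a copy of `j` and the sets represented by its tail. By laminarity, such a
set either extends along `a` or uses another arc from the same tail whose head contains `left j`
(`Shallow.insert_or_exists_uses`). The constraint at `p = left j` bounds `x a` plus the blocking
arcs by the weight of the represented sets, so the extendable sets weigh at least `x a`
(`Decomposes.le_extendable`). Different arcs into copies of `j` have disjoint families of extendable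
sets, so the right fraction of each family can be extended independently
(`Decomposes.exists_insert`). -/

namespace IntervalRep

section Laminar

open Classical

variable {V : Type*} {G : SimpleGraph V} (I : IntervalRep G)

/-! ### Containment and disjointness of intervals -/

/-- The interval of `v` lies strictly inside the interval of `w`. -/
def Inside (v w : V) : Prop := I.left w < I.left v ∧ I.right v < I.right w

theorem left_injective : Function.Injective I.left := fun i j h => by
  have := @I.endpoints_distinct (Sum.inl i) (Sum.inl j) h
  simpa using this

theorem right_injective : Function.Injective I.right := fun i j h => by
  have := @I.endpoints_distinct (Sum.inr i) (Sum.inr j) h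
  simpa using this

theorem left_ne_right (i j : V) : I.left i ≠ I.right j := fun h => by
  have := @I.endpoints_distinct (Sum.inl i) (Sum.inr j) h
  simp at this

theorem left_lt_right (i : V) : I.left i < I.right i :=
  lt_of_le_of_ne (I.left_le_right i) (I.left_ne_right i i)

variable {I}

theorem Inside.trans {u v w : V} (h : I.Inside u v) (h' : I.Inside v w) : I.Inside u w :=
  ⟨h'.1.trans h.1, h.2.trans h'.2⟩

theorem Inside.asymm {u v : V} (h : I.Inside u v) : ¬ I.Inside v u :=
  fun h' => lt_asymm h.1 h'.1

theorem Inside.ne {u v : V} (h : I.Inside u v) : u ≠ v := by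
  rintro rfl
  exact lt_irrefl _ h.1

variable (I)

theorem interval_ssubset_iff {v w : V} : I.interval v ⊂ I.interval w ↔ I.Inside v w := by
  unfold interval Inside
  rw [Set.ssubset_def, Set.Icc_subset_Icc_iff (I.left_le_right v),
    Set.Icc_subset_Icc_iff (I.left_le_right w)]
  constructor
  · rintro ⟨⟨h1, h2⟩, h3⟩
    have hne : v ≠ w := by
      rintro rfl
      exact h3 ⟨le_rfl, le_rfl⟩
    exact ⟨lt_of_le_of_ne h1 fun h => hne (I.left_injective h).symm,
      lt_of_le_of_ne h2 fun h => hne (I.right_injective h)⟩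
  · rintro ⟨h1, h2⟩
    exact ⟨⟨h1.le, h2.le⟩, fun h => absurd h.1 (not_le.2 h1)⟩

/-- Two vertices are nonadjacent exactly when their intervals are disjoint or nested. -/
theorem not_adj_iff {v w : V} (hne : v ≠ w) : ¬ G.Adj v w ↔
    I.right v < I.left w ∨ I.right w < I.left v ∨ I.Inside v w ∨ I.Inside w v := by
  have hv := I.left_lt_right v
  have hw := I.left_lt_right w
  have h1 : I.left v ≠ I.left w := fun h => hne (I.left_injective h)
  have h2 : I.right v ≠ I.right w := fun h => hne (I.right_injective h)
  rw [I.adj_iff, Set.Icc_inter_Icc, Set.nonempty_Icc, Set.Icc_subset_Icc_iff hv.le,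
    Set.Icc_subset_Icc_iff hw.le, sup_le_iff, le_inf_iff, le_inf_iff]
  unfold Inside
  grind

/-! ### The arborescence of a laminar set -/

/-- The members of `S` whose intervals strictly contain the interval of `v`. -/
noncomputable def ancestors (S : Finset V) (v : V) : Finset V := S.filter (I.Inside v)

/-- `S` is independent, and every member has fewer than `H` ancestors in `S`. -/
def Shallow (H : ℕ) (S : Finset V) : Prop :=
  G.IsIndepSet (S : Set V) ∧ ∀ v ∈ S, (I.ancestors S v).card < H

/-- The chain of members of `S` that ends at the vertex `u` of the layered digraph. -/
noncomputable def chain {H : ℕ} (S : Finset V) : LayerVertex V H → Finset V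
  | none => ∅
  | some (i, _) => insert i (I.ancestors S i)

/-- The copy `(i·h)` represents `S` if `i` is a member of `S` of depth `h`; the root always
represents `S`. -/
def Represents {H : ℕ} (S : Finset V) : LayerVertex V H → Prop
  | none => True
  | some (i, h) => i ∈ S ∧ (I.ancestors S i).card = h

/-- The arc `a` belongs to the arborescence of `S`. -/
def Uses {H : ℕ} (S : Finset V) (a : I.LayerArc H) : Prop :=
  I.Represents S a.tail ∧ I.Represents S (some a.head) ∧
    I.ancestors S a.head.1 = I.chain S a.tail

variable {I}

theorem mem_ancestors {S : Finset V} {v w : V} :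
    w ∈ I.ancestors S v ↔ w ∈ S ∧ I.Inside v w := by
  simp [ancestors]

theorem Shallow.trichotomy {H : ℕ} {S : Finset V} (hS : I.Shallow H S) {v w : V}
    (hv : v ∈ S) (hw : w ∈ S) : v = w ∨
    I.right v < I.left w ∨ I.right w < I.left v ∨ I.Inside v w ∨ I.Inside w v := by
  by_cases hne : v = w
  · exact Or.inl hne
  · exact Or.inr ((I.not_adj_iff hne).1 (hS.1 hv hw hne))

/-- Two members of `S` whose intervals share a point are equal or nested. -/
theorem Shallow.nested {H : ℕ} {S : Finset V} (hS : I.Shallow H S) {v w : V}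
    (hv : v ∈ S) (hw : w ∈ S) {p : ℝ} (hpv : p ∈ I.interval v) (hpw : p ∈ I.interval w) :
    v = w ∨ I.Inside v w ∨ I.Inside w v := by
  rcases hS.trichotomy hv hw with h | h | h | h
  · exact Or.inl h
  · exact absurd (hpw.1.trans hpv.2) (not_le.2 h)
  · exact absurd (hpv.1.trans hpw.2) (not_le.2 h)
  · exact Or.inr h

theorem Inside.mem_interval {v w : V} (h : I.Inside v w) {p : ℝ} (hp : p ∈ I.interval v) :
    p ∈ I.interval w := ⟨h.1.le.trans hp.1, hp.2.trans h.2.le⟩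

theorem left_mem_interval (v : V) : I.left v ∈ I.interval v := ⟨le_rfl, I.left_le_right v⟩

theorem notMem_ancestors_self (S : Finset V) (v : V) : v ∉ I.ancestors S v :=
  fun h => (mem_ancestors.1 h).2.ne rfl

theorem LayerArc.inside {H : ℕ} {a : I.LayerArc H} {i : V} {h : Fin H}
    (ha : a.tail = some (i, h)) : I.Inside a.head.1 i ∧ (a.head.2 : ℕ) = h + 1 := by
  obtain ⟨⟨u, j, k⟩, hadj⟩ := a
  simp only [LayerArc.tail] at ha
  subst ha
  exact ⟨I.interval_ssubset_iff.1 hadj.1, hadj.2⟩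

theorem LayerArc.head_eq_zero {H : ℕ} {a : I.LayerArc H} (ha : a.tail = none) :
    (a.head.2 : ℕ) = 0 := by
  obtain ⟨⟨u, j, k⟩, hadj⟩ := a
  simp only [LayerArc.tail] at ha
  subst ha
  exact hadj

theorem LayerArc.ext' {H : ℕ} {a b : I.LayerArc H} (ht : a.tail = b.tail)
    (hh : a.head = b.head) : a = b := Subtype.ext (Prod.ext ht hh)

theorem chain_card {H : ℕ} (S : Finset V) (i : V) (h : Fin H) :
    (I.chain S (some (i, h))).card = (I.ancestors S i).card + 1 :=
  Finset.card_insert_of_notMem (notMem_ancestors_self S i)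

/-- The tail of a used arc is determined by its head. -/
theorem Uses.eq_of_head {H : ℕ} {S : Finset V} {a b : I.LayerArc H} (ha : I.Uses S a)
    (hb : I.Uses S b) (h : a.head.1 = b.head.1) : a = b := by
  have hk : a.head.2 = b.head.2 := by
    have hka : (I.ancestors S a.head.1).card = a.head.2 := ha.2.1.2
    have hkb : (I.ancestors S b.head.1).card = b.head.2 := hb.2.1.2
    apply Fin.ext
    rw [← hka, ← hkb, h]
  refine LayerArc.ext' ?_ (Prod.ext h hk)
  have hc : I.chain S a.tail = I.chain S b.tail := by rw [← ha.2.2, ← hb.2.2, h]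
  have hra := ha.1
  have hrb := hb.1
  rcases hta : a.tail with _ | ⟨i, m⟩ <;> rcases htb : b.tail with _ | ⟨i', m'⟩
  · rfl
  · rw [hta, htb] at hc
    exact absurd hc.symm (Finset.insert_ne_empty _ _)
  · rw [hta, htb] at hc
    exact absurd hc (Finset.insert_ne_empty _ _)
  · rw [hta, htb] at hc
    rw [hta] at hra
    rw [htb] at hrb
    -- The tail is the innermost member of its chain: if the two differed, each would be a proper
    -- ancestor of the other.
    have hi : i = i' := by
      by_contra hne
      have h1 : i ∈ insert i' (I.ancestors S i') := by
        have : i ∈ insert i (I.ancestors S i) := Finset.mem_insert_self _ _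
        rwa [show insert i (I.ancestors S i) = insert i' (I.ancestors S i') from hc] at this
      have h2 : i' ∈ insert i (I.ancestors S i) := by
        have : i' ∈ insert i' (I.ancestors S i') := Finset.mem_insert_self _ _
        rwa [← show insert i (I.ancestors S i) = insert i' (I.ancestors S i') from hc] at this
      have h1' := (Finset.mem_insert.1 h1).resolve_left hne
      have h2' := (Finset.mem_insert.1 h2).resolve_left (Ne.symm hne)
      exact (mem_ancestors.1 h1').2.asymm (mem_ancestors.1 h2').2
    subst hi
    have hm : m = m' := Fin.ext (hra.2.symm.trans hrb.2)
    rw [hm]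

/-- The heads of used arcs with a common tail have disjoint intervals. -/
theorem Uses.eq_of_tail {H : ℕ} {S : Finset V} (hS : I.Shallow H S) {a b : I.LayerArc H}
    (ha : I.Uses S a) (hb : I.Uses S b) (h : a.tail = b.tail) {p : ℝ}
    (hpa : p ∈ I.interval a.head.1) (hpb : p ∈ I.interval b.head.1) : a = b := by
  refine ha.eq_of_head hb ?_
  have hc : I.ancestors S a.head.1 = I.ancestors S b.head.1 := by rw [ha.2.2, hb.2.2, h]
  rcases hS.nested ha.2.1.1 hb.2.1.1 hpa hpb with h | h | h
  · exact h
  · have : b.head.1 ∈ I.ancestors S a.head.1 := mem_ancestors.2 ⟨hb.2.1.1, h⟩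
    rw [hc] at this
    exact absurd this (notMem_ancestors_self _ _)
  · have : a.head.1 ∈ I.ancestors S b.head.1 := mem_ancestors.2 ⟨ha.2.1.1, h⟩
    rw [← hc] at this
    exact absurd this (notMem_ancestors_self _ _)

/-- Every member of a shallow set is the head of a used arc. -/
theorem Shallow.exists_uses {H : ℕ} {S : Finset V} (hS : I.Shallow H S) {v : V × Fin H}
    (hv : I.Represents S (some v)) : ∃ a : I.LayerArc H, a.head = v ∧ I.Uses S a := by
  obtain ⟨j, k⟩ := v
  obtain ⟨hjS, hk⟩ := hv
  rcases (I.ancestors S j).eq_empty_or_nonempty with he | hne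
  · have hk0 : (k : ℕ) = 0 := by rw [← hk, he, Finset.card_empty]
    exact ⟨⟨(none, (j, k)), hk0⟩, rfl, trivial, ⟨hjS, hk⟩, he⟩
  -- The ancestors of `j` all contain `left j`, so they are nested; the one with the largest left
  -- endpoint is the innermost, hence the parent of `j`.
  · obtain ⟨w, hw, hmax⟩ := Finset.exists_max_image _ I.left hne
    obtain ⟨hwS, hjw⟩ := mem_ancestors.1 hw
    have hc : I.ancestors S j = insert w (I.ancestors S w) := by
      ext v
      rw [Finset.mem_insert, mem_ancestors, mem_ancestors]
      constructor
      · rintro ⟨hvS, hjv⟩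
        rcases hS.nested hvS hwS (hjv.mem_interval (left_mem_interval j))
          (hjw.mem_interval (left_mem_interval j)) with h | h | h
        · exact Or.inl h
        · exact absurd h.1 (not_lt.2 (hmax v (mem_ancestors.2 ⟨hvS, hjv⟩)))
        · exact Or.inr ⟨hvS, h⟩
      · rintro (rfl | ⟨hvS, hwv⟩)
        · exact ⟨hwS, hjw⟩
        · exact ⟨hvS, hjw.trans hwv⟩
    have hcard : (k : ℕ) = (I.ancestors S w).card + 1 := by
      rw [← hk, hc, Finset.card_insert_of_notMem (notMem_ancestors_self S w)]
    exact ⟨⟨(some (w, ⟨_, hS.2 w hwS⟩), (j, k)), I.interval_ssubset_iff.2 hjw, hcard⟩, rfl,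
      ⟨hwS, rfl⟩, ⟨hjS, hk⟩, hc⟩

/-! ### Height as nesting depth -/

/-- The shallow sets are the independent sets of height at most `H`. -/
theorem shallow_iff {H : ℕ} {S : Finset V} :
    I.Shallow H S ↔ G.IsIndepSet (S : Set V) ∧ I.height S ≤ H := by
  have prec_or {A : Finset V} {v w : V} (hA : IsAntichain I.Prec (A : Set V)) (hv : v ∈ A)
      (hw : w ∈ A) : v = w ∨ I.left w < I.right v := by
    by_cases hne : v = w
    · exact Or.inl hne
    · exact Or.inr (not_le.1 fun h => hA hv hw hne (Or.inr h))
  constructor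
  · intro hS
    refine ⟨hS.1, Finset.sup_le fun A hA => ?_⟩
    rw [Finset.mem_filter, Finset.mem_powerset] at hA
    obtain ⟨hAS, hA⟩ := hA
    rcases A.eq_empty_or_nonempty with rfl | hne
    · simp
    -- No two members of an antichain are disjoint, so they are pairwise nested and all the others
    -- contain the one with the largest left endpoint.
    obtain ⟨v, hv, hmax⟩ := Finset.exists_max_image _ I.left hne
    have hsub : A ⊆ insert v (I.ancestors S v) := by
      intro w hw
      rw [Finset.mem_insert, mem_ancestors]
      rcases hS.trichotomy (hAS hv) (hAS hw) with h | h | h | h | h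
      · exact Or.inl h.symm
      · rcases prec_or hA hv hw with h' | h'
        · exact Or.inl h'.symm
        · exact absurd h (lt_asymm h')
      · rcases prec_or hA hw hv with h' | h'
        · exact Or.inl h'
        · exact absurd h (lt_asymm h')
      · exact Or.inr ⟨hAS hw, h⟩
      · exact absurd h.1 (not_lt.2 (hmax w hw))
    exact (Finset.card_le_card hsub).trans
      ((Finset.card_insert_le _ _).trans (hS.2 v (hAS hv)))
  · rintro ⟨hind, hh⟩
    refine ⟨hind, fun v hv => ?_⟩
    have hmem : ∀ w ∈ insert v (I.ancestors S v), I.left w ≤ I.left v ∧ I.right v ≤ I.right w := by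
      intro w hw
      rcases Finset.mem_insert.1 hw with rfl | hw
      · exact ⟨le_rfl, le_rfl⟩
      · exact ⟨(mem_ancestors.1 hw).2.1.le, (mem_ancestors.1 hw).2.2.le⟩
    -- All these intervals contain `I(v)`, which has positive length, so they form an antichain.
    have hle : (insert v (I.ancestors S v)).card ≤ I.height S := by
      refine Finset.le_sup (f := Finset.card) (Finset.mem_filter.2 ⟨Finset.mem_powerset.2 ?_, ?_⟩)
      · exact Finset.insert_subset hv (Finset.filter_subset _ _)
      · intro a ha b hb hne hab
        rcases hab with h | h
        · exact hne h
        · have := I.left_lt_right v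
          linarith [(hmem a ha).2, (hmem b hb).1]
    rw [Finset.card_insert_of_notMem (notMem_ancestors_self S v)] at hle
    omega

/-! ### Extending a set by the next vertex in the sweep -/

/-- Inserting a vertex to the right of `v` does not change the ancestors of `v`. -/
theorem ancestors_insert {S : Finset V} {j v : V} (h : I.left v < I.left j) :
    I.ancestors (insert j S) v = I.ancestors S v := by
  ext w
  rw [mem_ancestors, mem_ancestors, Finset.mem_insert]
  constructor
  · rintro ⟨rfl | hw, hi⟩
    · exact absurd hi.1 (lt_asymm h)
    · exact ⟨hw, hi⟩
  · exact fun h => ⟨Or.inr h.1, h.2⟩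

/-- The head of `a` and its tail, if not the root, start to the left of `j`, so `j` is neither of
them nor an ancestor of either. Values already matched on earlier arcs therefore survive the
insertion. -/
theorem uses_insert_iff {H : ℕ} {S : Finset V} {j : V} {a : I.LayerArc H}
    (h : I.left a.head.1 < I.left j) : I.Uses (insert j S) a ↔ I.Uses S a := by
  have hne : a.head.1 ≠ j := by
    rintro h'
    rw [h'] at h
    exact lt_irrefl _ h
  have hhead : I.Represents (insert j S) (some a.head) ↔ I.Represents S (some a.head) := by
    change a.head.1 ∈ insert j S ∧ (I.ancestors (insert j S) a.head.1).card = a.head.2 ↔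
      a.head.1 ∈ S ∧ (I.ancestors S a.head.1).card = a.head.2
    rw [ancestors_insert h, Finset.mem_insert, or_iff_right hne]
  unfold Uses
  rw [hhead, ancestors_insert h]
  rcases hta : a.tail with _ | ⟨i, m⟩
  · rfl
  · have hi : I.left i < I.left j := (LayerArc.inside hta).1.1.trans h
    have hij : i ≠ j := by
      rintro rfl
      exact lt_irrefl _ hi
    simp only [Represents, chain, ancestors_insert hi, Finset.mem_insert, or_iff_right hij]

/-- A shallow set represented by the tail of `a` can be extended along `a` by a vertex to the
right of all its members, unless it uses an arc with the same tail whose head blocks `a`. -/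
theorem Shallow.insert_or_exists_uses {H : ℕ} {S : Finset V} (hS : I.Shallow H S) {j : V}
    (hj : ∀ v ∈ S, I.left v < I.left j) {a : I.LayerArc H} (haj : a.head.1 = j)
    (ha : I.Represents S a.tail) :
    (I.Shallow H (insert j S) ∧ I.Uses (insert j S) a) ∨
      ∃ b : I.LayerArc H, b.tail = a.tail ∧ I.left j ∈ I.interval b.head.1 ∧ I.Uses S b := by
  have hjS : j ∉ S := fun h => lt_irrefl _ (hj j h)
  have hcard : (I.chain S a.tail).card = a.head.2 := by
    rcases hta : a.tail with _ | ⟨i, m⟩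
    · rw [LayerArc.head_eq_zero hta]
      rfl
    · rw [hta] at ha
      rw [chain_card, (LayerArc.inside hta).2, ha.2]
  have hchain : ∀ v ∈ I.chain S a.tail, v ∈ S ∧ I.Inside j v := by
    rcases hta : a.tail with _ | ⟨i, m⟩
    · simp [chain]
    · rw [hta] at ha
      have hji := (LayerArc.inside hta).1
      rw [haj] at hji
      intro v hv
      rcases Finset.mem_insert.1 hv with rfl | hv
      · exact ⟨ha.1, hji⟩
      · exact ⟨(mem_ancestors.1 hv).1, hji.trans (mem_ancestors.1 hv).2⟩
  -- The obstructions are the members that contain `left j` but are not on the chain of the tail.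
  -- Without them, the members containing `left j` are exactly the chain, and every other member
  -- ends before `j` starts.
  rcases (S.filter fun v => I.left j ∈ I.interval v ∧ v ∉ I.chain S a.tail).eq_empty_or_nonempty
    with he | hne
  · left
    have hact : ∀ v ∈ S, I.left j ∈ I.interval v → v ∈ I.chain S a.tail := by
      intro v hv hjv
      by_contra hvc
      have : v ∈ S.filter fun v => I.left j ∈ I.interval v ∧ v ∉ I.chain S a.tail :=
        Finset.mem_filter.2 ⟨hv, hjv, hvc⟩
      rw [he] at this
      exact absurd this (Finset.notMem_empty v)
    have hanc : I.ancestors (insert j S) j = I.chain S a.tail := by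
      ext v
      rw [mem_ancestors, Finset.mem_insert]
      constructor
      · rintro ⟨rfl | hv, hi⟩
        · exact absurd rfl hi.ne
        · exact hact v hv (hi.mem_interval (left_mem_interval j))
      · exact fun hv => ⟨Or.inr (hchain v hv).1, (hchain v hv).2⟩
    have hnadj : ∀ v ∈ S, ¬ G.Adj v j := by
      intro v hv
      have hne : v ≠ j := fun h => hjS (h ▸ hv)
      rw [I.not_adj_iff hne]
      by_cases hjv : I.left j ∈ I.interval v
      · exact Or.inr (Or.inr (Or.inr (hchain v (hact v hv hjv)).2))
      · left
        by_contra hr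
        exact hjv ⟨(hj v hv).le, not_lt.1 hr⟩
    refine ⟨⟨?_, ?_⟩, ?_, ?_, ?_⟩
    · intro v hv w hw hvw
      rw [Finset.coe_insert, Set.mem_insert_iff] at hv hw
      rcases hv with rfl | hv <;> rcases hw with rfl | hw
      · exact absurd rfl hvw
      · exact fun h => hnadj w hw h.symm
      · exact hnadj v hv
      · exact hS.1 hv hw hvw
    · intro v hv
      rcases Finset.mem_insert.1 hv with rfl | hv
      · rw [hanc, hcard]
        exact a.head.2.2
      · rw [ancestors_insert (hj v hv)]
        exact hS.2 v hv
    · rcases hta : a.tail with _ | ⟨i, m⟩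
      · trivial
      · rw [hta] at ha
        exact ⟨Finset.mem_insert_of_mem ha.1, by rw [ancestors_insert (hj i ha.1), ha.2]⟩
    · change a.head.1 ∈ insert j S ∧ (I.ancestors (insert j S) a.head.1).card = a.head.2
      rw [haj, hanc, hcard]
      exact ⟨Finset.mem_insert_self _ _, rfl⟩
    · rw [haj, hanc]
      rcases hta : a.tail with _ | ⟨i, m⟩
      · rfl
      · rw [hta] at ha
        simp only [chain, ancestors_insert (hj i ha.1)]
  · right
    -- Take the outermost obstruction: its ancestors are exactly the chain, so it is a child of the
    -- tail of `a` and lies in the same layer as the head of `a`.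
    obtain ⟨w, hw, hmin⟩ := Finset.exists_min_image _ I.left hne
    obtain ⟨hwS, hjw, hwc⟩ := Finset.mem_filter.1 hw
    have hup : ∀ v ∈ I.chain S a.tail, I.Inside w v := by
      rcases hta : a.tail with _ | ⟨i, m⟩
      · simp [chain]
      · rw [hta] at ha hwc hchain
        have hci : i ∈ I.chain S (some (i, m)) := Finset.mem_insert_self _ _
        have hwi : I.Inside w i := by
          rcases hS.nested hwS ha.1 hjw ((hchain i hci).2.mem_interval (left_mem_interval j))
            with h | h | h
          · exact absurd (h ▸ hci) hwc
          · exact h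
          · exact absurd (Finset.mem_insert_of_mem (mem_ancestors.2 ⟨hwS, h⟩)) hwc
        intro v hv
        rcases Finset.mem_insert.1 hv with rfl | hv
        · exact hwi
        · exact hwi.trans (mem_ancestors.1 hv).2
    have hanc : I.ancestors S w = I.chain S a.tail := by
      ext v
      rw [mem_ancestors]
      constructor
      · rintro ⟨hv, hi⟩
        by_contra hvc
        exact absurd hi.1 (not_lt.2 (hmin v (Finset.mem_filter.2 ⟨hv, hi.mem_interval hjw, hvc⟩)))
      · exact fun hv => ⟨(hchain v hv).1, hup v hv⟩
    have hadj : (I.layerDigraph H).Adj a.tail (some (w, a.head.2)) := by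
      rcases hta : a.tail with _ | ⟨i, m⟩
      · exact LayerArc.head_eq_zero hta
      · rw [hta] at hup
        exact ⟨I.interval_ssubset_iff.2 (hup i (Finset.mem_insert_self _ _)),
          (LayerArc.inside hta).2⟩
    exact ⟨⟨(a.tail, (w, a.head.2)), hadj⟩, rfl, hjw, ha, ⟨hwS, by rw [← hcard, ← hanc]⟩, hanc⟩

/-! ### From weighted sets to arc vectors -/

theorem cliqueMatrix_apply (p : I.endpoints) (v : V) :
    I.cliqueMatrix p v = if (p : ℝ) ∈ I.interval v then 1 else 0 := rfl

/-- A member of a shallow set is represented by exactly one of its copies. -/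
theorem Shallow.sum_represents {H : ℕ} {S : Finset V} (hS : I.Shallow H S) (j : V) (t : ℝ) :
    ∑ h : Fin H, (if I.Represents S (some (j, h)) then t else 0) = if j ∈ S then t else 0 := by
  split_ifs with hj
  · rw [Finset.sum_eq_single (⟨_, hS.2 j hj⟩ : Fin H), if_pos ⟨hj, rfl⟩]
    · intro b _ hne
      exact if_neg fun h => hne (Fin.ext h.2.symm)
    · simp
  · exact Finset.sum_eq_zero fun h _ => if_neg fun hr => hj hr.1

variable [Fintype V]

theorem mem_inArcs {H : ℕ} {v : V × Fin H} {a : I.LayerArc H} :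
    a ∈ I.inArcs v ↔ a.head = v := by
  simp [inArcs]

theorem mem_outArcs {H : ℕ} {u : LayerVertex V H} {a : I.LayerArc H} :
    a ∈ I.outArcs u ↔ a.tail = u := by
  simp [outArcs]

/-- Exactly one used arc enters each copy that represents `S`. -/
theorem Shallow.sum_inArcs {H : ℕ} {S : Finset V} (hS : I.Shallow H S) (v : V × Fin H) (t : ℝ) :
    ∑ a ∈ I.inArcs v, (if I.Uses S a then t else 0) =
      if I.Represents S (some v) then t else 0 := by
  split_ifs with hv
  · obtain ⟨a, hav, ha⟩ := hS.exists_uses hv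
    rw [Finset.sum_eq_single a, if_pos ha]
    · intro b hb hne
      refine if_neg fun hub => hne (hub.eq_of_head ha ?_)
      rw [mem_inArcs.1 hb, hav]
    · exact fun h => absurd (mem_inArcs.2 hav) h
  · refine Finset.sum_eq_zero fun a ha => if_neg fun hu => hv ?_
    rw [← mem_inArcs.1 ha]
    exact hu.2.1

/-- Each point is covered by at most one used arc that leaves a given vertex. -/
theorem Shallow.sum_outArcs_le {H : ℕ} {S : Finset V} (hS : I.Shallow H S) (u : LayerVertex V H)
    (p : I.endpoints) {t : ℝ} (ht : 0 ≤ t) :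
    ∑ a ∈ I.outArcs u, I.cliqueMatrix p a.head.1 * (if I.Uses S a then t else 0) ≤
      if I.Represents S u then t else 0 := by
  have hterm : ∀ a : I.LayerArc H,
      I.cliqueMatrix p a.head.1 * (if I.Uses S a then t else 0) ≠ 0 →
        (p : ℝ) ∈ I.interval a.head.1 ∧ I.Uses S a := by
    intro a h
    rw [cliqueMatrix_apply] at h
    by_contra hc
    rw [not_and_or] at hc
    rcases hc with hc | hc <;> simp [hc] at h
  by_cases hex : ∃ a ∈ I.outArcs u, (p : ℝ) ∈ I.interval a.head.1 ∧ I.Uses S a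
  · obtain ⟨a, hau, hpa, ha⟩ := hex
    have hu : I.Represents S u := mem_outArcs.1 hau ▸ ha.1
    rw [Finset.sum_eq_single a, cliqueMatrix_apply, if_pos hpa, if_pos ha, if_pos hu, one_mul]
    · intro b hb hne
      by_contra h0
      obtain ⟨hpb, hub⟩ := hterm b h0
      exact hne (hub.eq_of_tail hS ha ((mem_outArcs.1 hb).trans (mem_outArcs.1 hau).symm) hpb hpa)
    · exact fun h => absurd hau h
  · rw [Finset.sum_eq_zero]
    · split_ifs
      · exact ht
      · exact le_rfl
    · intro a ha
      by_contra h0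
      exact hex ⟨a, ha, hterm a h0⟩

/-- A conical combination of shallow sets induces a feasible solution of the arc formulation. -/
theorem cgConstraints_of_shallow {H : ℕ} {q : Finset V → ℝ} (hq0 : 0 ≤ q)
    (hq : ∀ S, q S ≠ 0 → I.Shallow H S)
    (hcov : ∀ j : V, ∑ S : Finset V, (if j ∈ S then q S else 0) = 1) :
    I.CGConstraints H (fun a => ∑ S : Finset V, if I.Uses S a then q S else 0) (∑ S, q S) := by
  have hin : ∀ v : V × Fin H,
      ∑ a ∈ I.inArcs v, ∑ S : Finset V, (if I.Uses S a then q S else 0) =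
        ∑ S : Finset V, if I.Represents S (some v) then q S else 0 := by
    intro v
    rw [Finset.sum_comm]
    refine Finset.sum_congr rfl fun S _ => ?_
    by_cases h0 : q S = 0
    · simp [h0]
    · exact (hq S h0).sum_inArcs v _
  have hout : ∀ (u : LayerVertex V H) (p : I.endpoints),
      ∑ a ∈ I.outArcs u, I.cliqueMatrix p a.head.1 *
        ∑ S : Finset V, (if I.Uses S a then q S else 0) ≤
          ∑ S : Finset V, if I.Represents S u then q S else 0 := by
    intro u p
    simp_rw [Finset.mul_sum]
    rw [Finset.sum_comm]
    refine Finset.sum_le_sum fun S _ => ?_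
    by_cases h0 : q S = 0
    · simp [h0]
    · exact (hq S h0).sum_outArcs_le u p (hq0 S)
  refine ⟨fun p => (hout none p).trans (le_of_eq ?_), fun i _ h _ p => ?_, fun j => ?_⟩
  · exact Finset.sum_congr rfl fun S _ => if_pos trivial
  · rw [hin]
    exact hout _ p
  · simp_rw [hin]
    rw [Finset.sum_comm, ← hcov j]
    refine Finset.sum_congr rfl fun S _ => ?_
    by_cases h0 : q S = 0
    · simp [h0]
    · exact (hq S h0).sum_represents j _

/-! ### From arc vectors to weighted sets -/

/-- Weights on the subsets of `T` that are supported on shallow sets, have total `c` and induce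
the vector `x` on the arcs with head in `T`. -/
structure Decomposes {H : ℕ} (x : I.LayerArc H → ℝ) (c : ℝ) (T : Finset V)
    (q : Finset V → ℝ) : Prop where
  nonneg : 0 ≤ q
  shallow : ∀ S ⊆ T, q S ≠ 0 → I.Shallow H S
  total : ∑ S ∈ T.powerset, q S = c
  arc : ∀ a : I.LayerArc H, a.head.1 ∈ T →
    ∑ S ∈ T.powerset, (if I.Uses S a then q S else 0) = x a

/-- The weight of the sets that can be extended along `a` is at least `x a`. -/
theorem Decomposes.le_extendable {H : ℕ} {x : I.LayerArc H → ℝ} {c : ℝ} {T : Finset V}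
    {q : Finset V → ℝ} (hq : Decomposes x c T q) (hx : I.CGConstraints H x c) (hx0 : 0 ≤ x)
    {j : V} (hjT : ∀ v, v ∈ T ↔ I.left v < I.left j) {a : I.LayerArc H} (haj : a.head.1 = j) :
    x a ≤ ∑ S ∈ T.powerset,
      if I.Shallow H (insert j S) ∧ I.Uses (insert j S) a then q S else 0 := by
  -- At this point the head of `a` and the heads of all blocking arcs in `B` are counted with
  -- coefficient 1.
  let p : I.endpoints := ⟨I.left j, Or.inl ⟨j, rfl⟩⟩
  let B : Finset (I.LayerArc H) :=
    (I.outArcs a.tail).filter fun b => b.head.1 ∈ T ∧ I.left j ∈ I.interval b.head.1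
  -- For the root the right side is the total weight `c`. For a copy of `i`, the interval of `i`
  -- contains that of `j`, so `i ∈ T` and the entering arcs are already decomposed.
  have hrep : ∑ b ∈ I.outArcs a.tail, I.cliqueMatrix p b.head.1 * x b ≤
      ∑ S ∈ T.powerset, if I.Represents S a.tail then q S else 0 := by
    rcases hta : a.tail with _ | ⟨i, m⟩
    · refine (hx.root_le p).trans (le_of_eq ?_)
      rw [← hq.total]
      exact Finset.sum_congr rfl fun S _ => (if_pos trivial).symm
    · obtain ⟨hin, hm⟩ := LayerArc.inside hta
      have hiT : i ∈ T := (hjT i).2 (haj ▸ hin.1)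
      refine (hx.copy_le i ⟨_, I.interval_ssubset_iff.2 hin⟩ m (hm ▸ a.head.2.2) p).trans
        (le_of_eq ?_)
      have h1 : ∀ b ∈ I.inArcs (i, m),
          x b = ∑ S ∈ T.powerset, if I.Uses S b then q S else 0 := by
        intro b hb
        refine (hq.arc b ?_).symm
        rw [mem_inArcs.1 hb]
        exact hiT
      rw [Finset.sum_congr rfl h1, Finset.sum_comm]
      refine Finset.sum_congr rfl fun S hS => ?_
      by_cases h0 : q S = 0
      · simp [h0]
      · exact (hq.shallow S (Finset.mem_powerset.1 hS) h0).sum_inArcs _ _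
  have haB : a ∉ B := by
    intro h
    have := (hjT _).1 (Finset.mem_filter.1 h).2.1
    rw [haj] at this
    exact lt_irrefl _ this
  have hlow : x a + ∑ b ∈ B, x b ≤ ∑ b ∈ I.outArcs a.tail, I.cliqueMatrix p b.head.1 * x b := by
    rw [← Finset.sum_insert haB]
    have h1 : ∀ b ∈ insert a B, x b = I.cliqueMatrix p b.head.1 * x b := by
      intro b hb
      rw [cliqueMatrix_apply, if_pos, one_mul]
      rcases Finset.mem_insert.1 hb with rfl | hb
      · rw [haj]
        exact left_mem_interval j
      · exact (Finset.mem_filter.1 hb).2.2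
    rw [Finset.sum_congr rfl h1]
    refine Finset.sum_le_sum_of_subset_of_nonneg ?_ fun b _ _ => mul_nonneg ?_ (hx0 b)
    · exact Finset.insert_subset (mem_outArcs.2 rfl) (Finset.filter_subset _ _)
    · rw [cliqueMatrix_apply]
      split_ifs
      · exact zero_le_one
      · exact le_rfl
  have hup : ∑ S ∈ T.powerset, (if I.Represents S a.tail then q S else 0) ≤
      (∑ S ∈ T.powerset, if I.Shallow H (insert j S) ∧ I.Uses (insert j S) a then q S else 0) +
        ∑ b ∈ B, x b := by
    have h1 : ∀ b ∈ B, x b = ∑ S ∈ T.powerset, if I.Uses S b then q S else 0 :=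
      fun b hb => (hq.arc b (Finset.mem_filter.1 hb).2.1).symm
    rw [Finset.sum_congr rfl h1, Finset.sum_comm, ← Finset.sum_add_distrib]
    refine Finset.sum_le_sum fun S hS => ?_
    have hST := Finset.mem_powerset.1 hS
    have hnn : ∀ (P : Prop) [Decidable P], 0 ≤ if P then q S else 0 := by
      intro P _
      split_ifs
      · exact hq.nonneg S
      · exact le_rfl
    by_cases hr : I.Represents S a.tail
    swap
    · rw [if_neg hr]
      exact add_nonneg (hnn _) (Finset.sum_nonneg fun b _ => hnn _)
    by_cases h0 : q S = 0
    · simp [h0]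
    rw [if_pos hr]
    rcases (hq.shallow S hST h0).insert_or_exists_uses (fun v hv => (hjT v).1 (hST hv)) haj hr
      with h | ⟨b, hbt, hbj, hb⟩
    · rw [if_pos h]
      exact le_add_of_nonneg_right (Finset.sum_nonneg fun b _ => hnn _)
    · have hbB : b ∈ B :=
        Finset.mem_filter.2 ⟨mem_outArcs.2 hbt, hST hb.2.1.1, hbj⟩
      refine le_add_of_nonneg_of_le (hnn _) ?_
      calc q S = if I.Uses S b then q S else 0 := (if_pos hb).symm
        _ ≤ _ := Finset.single_le_sum (f := fun b => if I.Uses S b then q S else 0)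
          (fun b _ => hnn _) hbB
  linarith

/-- A decomposition on `T` extends by the next vertex to the right. -/
theorem Decomposes.exists_insert {H : ℕ} {x : I.LayerArc H → ℝ} {c : ℝ} {T : Finset V}
    {q : Finset V → ℝ} (hq : Decomposes x c T q) (hx : I.CGConstraints H x c) (hx0 : 0 ≤ x)
    {j : V} (hjT : ∀ v, v ∈ T ↔ I.left v < I.left j) :
    ∃ q' : Finset V → ℝ, Decomposes x c (insert j T) q' := by
  have hj : j ∉ T := fun h => lt_irrefl _ ((hjT j).1 h)
  let W : I.LayerArc H → ℝ := fun a => ∑ S ∈ T.powerset,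
    if I.Shallow H (insert j S) ∧ I.Uses (insert j S) a then q S else 0
  have hW : ∀ a : I.LayerArc H, a.head.1 = j → x a ≤ W a :=
    fun a ha => hq.le_extendable hx hx0 hjT ha
  -- `t S` is the fraction of the weight of `S` to be moved to `insert j S`. The arc with head `j`
  -- used by `insert j S` is unique, so the choice below is forced.
  obtain ⟨t, ht0, ht1, hts, hta⟩ : ∃ t : Finset V → ℝ, (∀ S, 0 ≤ t S) ∧ (∀ S, t S ≤ 1) ∧
      (∀ S, t S ≠ 0 → I.Shallow H (insert j S)) ∧
      ∀ S, ∀ a : I.LayerArc H, a.head.1 = j → I.Shallow H (insert j S) →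
        I.Uses (insert j S) a → t S = x a / W a := by
    refine ⟨fun S => if h : ∃ a : I.LayerArc H,
      a.head.1 = j ∧ I.Shallow H (insert j S) ∧ I.Uses (insert j S) a then
        x h.choose / W h.choose else 0, fun S => ?_, fun S => ?_, fun S hS => ?_, ?_⟩
    · dsimp only
      split_ifs with h
      · exact div_nonneg (hx0 _) ((hx0 _).trans (hW _ h.choose_spec.1))
      · exact le_rfl
    · dsimp only
      split_ifs with h
      · exact div_le_one_of_le₀ (hW _ h.choose_spec.1) ((hx0 _).trans (hW _ h.choose_spec.1))
      · exact zero_le_one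
    · by_contra hn
      refine hS (dif_neg ?_)
      rintro ⟨a, -, h, -⟩
      exact hn h
    · intro S a ha hS hu
      have h : ∃ a : I.LayerArc H,
          a.head.1 = j ∧ I.Shallow H (insert j S) ∧ I.Uses (insert j S) a := ⟨a, ha, hS, hu⟩
      have he : h.choose = a :=
        h.choose_spec.2.2.eq_of_head hu (h.choose_spec.1.trans ha.symm)
      dsimp only
      rw [dif_pos h, he]
  let q' : Finset V → ℝ := fun S =>
    if j ∈ S then q (S.erase j) * t (S.erase j) else q S * (1 - t S)
  have hold : ∀ S ∈ T.powerset, q' S = q S * (1 - t S) :=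
    fun S hS => if_neg fun h => hj (Finset.mem_powerset.1 hS h)
  have hnew : ∀ S ∈ T.powerset, q' (insert j S) = q S * t S := by
    intro S hS
    have hjS : j ∉ S := fun h => hj (Finset.mem_powerset.1 hS h)
    change (if j ∈ insert j S then _ else _) = _
    rw [if_pos (Finset.mem_insert_self _ _), Finset.erase_insert hjS]
  refine ⟨q', ⟨fun S => ?_, fun S hS hS0 => ?_, ?_, fun a ha => ?_⟩⟩
  · change 0 ≤ if j ∈ S then q (S.erase j) * t (S.erase j) else q S * (1 - t S)
    split_ifs
    · exact mul_nonneg (hq.nonneg _) (ht0 _)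
    · exact mul_nonneg (hq.nonneg _) (sub_nonneg.2 (ht1 _))
  · by_cases hjS : j ∈ S
    · have h1 : q' S = q (S.erase j) * t (S.erase j) := if_pos hjS
      rw [h1] at hS0
      have := hts _ (right_ne_zero_of_mul hS0)
      rwa [Finset.insert_erase hjS] at this
    · have h1 : q' S = q S * (1 - t S) := if_neg hjS
      rw [h1] at hS0
      exact hq.shallow S ((Finset.subset_insert_iff_of_notMem hjS).1 hS) (left_ne_zero_of_mul hS0)
  · rw [Finset.sum_powerset_insert hj, Finset.sum_congr rfl hold, Finset.sum_congr rfl hnew,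
      ← Finset.sum_add_distrib, ← hq.total]
    exact Finset.sum_congr rfl fun S _ => by ring
  · rw [Finset.sum_powerset_insert hj, ← Finset.sum_add_distrib]
    rcases Finset.mem_insert.1 ha with haj | haT
    · have hterm : ∀ S ∈ T.powerset, (if I.Uses S a then q' S else 0) +
          (if I.Uses (insert j S) a then q' (insert j S) else 0) =
          (if I.Shallow H (insert j S) ∧ I.Uses (insert j S) a then q S else 0) *
            (x a / W a) := by
        intro S hS
        have hjS : j ∉ S := fun h => hj (Finset.mem_powerset.1 hS h)
        have hnu : ¬ I.Uses S a := fun h => hjS (haj ▸ h.2.1.1)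
        rw [if_neg hnu, zero_add, hnew S hS]
        by_cases hu : I.Uses (insert j S) a
        · by_cases hs : I.Shallow H (insert j S)
          · rw [if_pos hu, if_pos ⟨hs, hu⟩, hta S a haj hs hu]
          · have : t S = 0 := by
              by_contra h
              exact hs (hts S h)
            simp [this, hs]
        · simp [hu]
      rw [Finset.sum_congr rfl hterm, ← Finset.sum_mul]
      change W a * (x a / W a) = x a
      -- Here `x a / W a` is `0` by convention, which is correct since `0 ≤ x a ≤ W a`.
      by_cases hw : W a = 0
      · have : x a = 0 := le_antisymm (hw ▸ hW a haj) (hx0 a)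
        rw [hw, this, zero_mul]
      · exact mul_div_cancel₀ _ hw
    -- For an old arc, `S` and `insert j S` both use it or both do not, and their new weights add up
    -- to `q S`.
    · rw [← hq.arc a haT]
      refine Finset.sum_congr rfl fun S hS => ?_
      rw [uses_insert_iff ((hjT _).1 haT), hold S hS, hnew S hS]
      split_ifs
      · ring
      · exact add_zero 0

/-- Induction over the initial segments of the order by left endpoint; each step adds the vertex
that starts next. -/
theorem exists_decomposes {H : ℕ} {x : I.LayerArc H → ℝ} {c : ℝ}
    (hx : I.CGConstraints H x c) (hx0 : 0 ≤ x) (hc : 0 ≤ c) :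
    ∃ q : Finset V → ℝ, Decomposes x c Finset.univ q := by
  have key : ∀ T : Finset V, (∀ v ∈ T, ∀ w, I.left w < I.left v → w ∈ T) →
      ∃ q : Finset V → ℝ, Decomposes x c T q := by
    intro T
    induction T using Finset.induction_on_max_value I.left with
    | empty =>
      intro _
      -- Only the value at `∅` counts here: the whole weight `c` starts on the empty set.
      refine ⟨fun _ => c, fun _ => hc, fun S hS _ => ?_, ?_, fun a ha => ?_⟩
      · rw [Finset.subset_empty.1 hS]
        exact ⟨by simp, by simp⟩
      · simp
      · exact absurd ha (Finset.notMem_empty _)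
    | insert j T hjT hmax ih =>
      intro hdown
      have hlt : ∀ v ∈ T, I.left v < I.left j := fun v hv =>
        lt_of_le_of_ne (hmax v hv) fun h => hjT (I.left_injective h ▸ hv)
      have hiff : ∀ v, v ∈ T ↔ I.left v < I.left j := by
        refine fun v => ⟨hlt v, fun h => ?_⟩
        refine (Finset.mem_insert.1 (hdown j (Finset.mem_insert_self _ _) v h)).resolve_left ?_
        rintro rfl
        exact lt_irrefl _ h
      obtain ⟨q, hq⟩ := ih fun v hv w hw => (hiff w).2 (hw.trans (hlt v hv))
      exact hq.exists_insert hx hx0 hiff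
  exact key _ fun _ _ w _ => Finset.mem_univ w

/-! ### Equality of the value sets and existence of an optimum -/

variable (I)

/-- Extending weights by zero replaces the index type `Ξ_H` by all vertex sets, so that sets can
grow during the sweep without carrying proofs. -/
theorem mem_pRelaxationValues_iff {H : ℕ} {t : ℝ} : t ∈ I.pRelaxationValues H ↔
    ∃ q : Finset V → ℝ, 0 ≤ q ∧ (∀ S, q S ≠ 0 → I.Shallow H S) ∧
      (∀ j : V, ∑ S : Finset V, (if j ∈ S then q S else 0) = 1) ∧ t = ∑ S, q S := by
  have hsum : ∀ f : Finset V → ℝ, (∀ S, f S ≠ 0 → I.Shallow H S) →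
      ∑ S : I.IndepOfHeight H, f S.1 = ∑ S, f S := by
    intro f hf
    refine Finset.sum_of_injOn (fun S : I.IndepOfHeight H => S.1)
      (fun S _ T _ h => Subtype.ext h) (by simp) ?_ (by simp)
    intro S _ hS
    by_contra h0
    exact hS ⟨⟨S, shallow_iff.1 (hf S h0)⟩, Finset.mem_coe.2 (Finset.mem_univ _), rfl⟩
  have hmul : ∀ (q : I.IndepOfHeight H → ℝ) (j : V), (I.indepMatrix H *ᵥ q) j =
      ∑ S : I.IndepOfHeight H, if j ∈ S.1 then q S else 0 := by
    intro q j
    simp only [Matrix.mulVec, dotProduct, indepMatrix, Matrix.of_apply, ite_mul, one_mul, zero_mul]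
  constructor
  · rintro ⟨q, hq, hq0, rfl⟩
    let r : Finset V → ℝ := fun S =>
      if h : G.IsIndepSet (S : Set V) ∧ I.height S ≤ H then q ⟨S, h⟩ else 0
    have hr : ∀ S : I.IndepOfHeight H, r S.1 = q S := fun S => dif_pos S.2
    have hrs : ∀ S, r S ≠ 0 → I.Shallow H S := by
      intro S hS
      rw [shallow_iff]
      by_contra h
      exact hS (dif_neg h)
    refine ⟨r, fun S => ?_, hrs, fun j => ?_, ?_⟩
    · change 0 ≤ dite _ _ _
      split_ifs
      · exact hq0 _
      · exact le_rfl
    · rw [← hsum (fun S => if j ∈ S then r S else 0) fun S hS =>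
        hrs S fun h0 => hS (by simp [h0])]
      simp_rw [hr]
      rw [← hmul, hq]
      rfl
    · rw [← hsum r hrs]
      simp_rw [hr]
      simp [dotProduct]
  · rintro ⟨q, hq0, hqs, hq, rfl⟩
    refine ⟨fun S => q S.1, ?_, fun S => hq0 _, ?_⟩
    · ext j
      rw [hmul, hsum (fun S => if j ∈ S then q S else 0) fun S hS =>
        hqs S fun h0 => hS (by simp [h0]), hq j]
      rfl
    · rw [← hsum q hqs]
      simp [dotProduct]

/-- The two relaxations attain the same objective values. -/
theorem cgRelaxationValues_eq (H : ℕ) : I.cgRelaxationValues H = I.pRelaxationValues H := by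
  ext c
  rw [mem_pRelaxationValues_iff]
  constructor
  · rintro ⟨x, hx, hx0, hc⟩
    obtain ⟨q, hq⟩ := exists_decomposes hx hx0 hc
    have hs : ∀ S, q S ≠ 0 → I.Shallow H S := fun S => hq.shallow S (Finset.subset_univ S)
    refine ⟨q, hq.nonneg, hs, fun j => ?_, ?_⟩
    · rw [← hx.cover j]
      have h1 : ∀ a : I.LayerArc H, x a = ∑ S : Finset V, if I.Uses S a then q S else 0 := by
        intro a
        rw [← hq.arc a (Finset.mem_univ _), Finset.powerset_univ]
      have h2 : ∀ h : Fin H, ∑ a ∈ I.inArcs (j, h), x a =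
          ∑ S : Finset V, if I.Represents S (some (j, h)) then q S else 0 := by
        intro h
        rw [Finset.sum_congr rfl fun a _ => h1 a, Finset.sum_comm]
        refine Finset.sum_congr rfl fun S _ => ?_
        by_cases h0 : q S = 0
        · simp [h0]
        · exact (hs S h0).sum_inArcs _ _
      rw [Finset.sum_congr rfl fun h _ => h2 h, Finset.sum_comm]
      refine Finset.sum_congr rfl fun S _ => ?_
      by_cases h0 : q S = 0
      · simp [h0]
      · exact ((hs S h0).sum_represents j _).symm
    · rw [← hq.total, Finset.powerset_univ]
  · rintro ⟨q, hq0, hqs, hq, rfl⟩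
    refine ⟨_, cgConstraints_of_shallow hq0 hqs hq, fun a => ?_, Finset.sum_nonneg fun S _ => hq0 S⟩
    refine Finset.sum_nonneg fun S _ => ?_
    split_ifs
    · exact hq0 S
    · exact le_rfl

/-- The singletons, each with weight 1, cover every vertex once; they have depth 1, which `H ≥ 1`
allows. -/
theorem pRelaxationValues_nonempty {H : ℕ} (hH : 1 ≤ H) : (I.pRelaxationValues H).Nonempty := by
  refine ⟨_, I.mem_pRelaxationValues_iff.2
    ⟨fun S => if S.card = 1 then 1 else 0, fun S => ?_, fun S hS => ?_, fun j => ?_, rfl⟩⟩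
  · dsimp only
    split_ifs
    · exact zero_le_one
    · exact le_rfl
  · have hS1 : S.card = 1 := by
      by_contra h
      exact hS (if_neg h)
    obtain ⟨v, rfl⟩ := Finset.card_eq_one.1 hS1
    refine ⟨by simp, fun w hw => ?_⟩
    have : I.ancestors {v} w ⊂ {v} := by
      refine (Finset.filter_subset _ _).ssubset_of_ne fun h => ?_
      exact notMem_ancestors_self _ w (h.symm ▸ hw)
    have := Finset.card_lt_card this
    rw [Finset.card_singleton] at this
    omega
  · rw [Finset.sum_eq_single {j}]
    · simp
    · intro S _ hne
      by_cases hj : j ∈ S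
      · rw [if_pos hj]
        refine if_neg fun h1 => hne ?_
        obtain ⟨v, rfl⟩ := Finset.card_eq_one.1 h1
        rw [Finset.mem_singleton.1 hj]
      · exact if_neg hj
    · simp

/-- The relaxation of the set partitioning problem has an optimal solution. -/
theorem exists_isLeast_pRelaxationValues {H : ℕ} (hH : 1 ≤ H) :
    ∃ v, IsLeast (I.pRelaxationValues H) v := by
  obtain ⟨t₀, q₀, hq₀, hq₀0, rfl⟩ := I.pRelaxationValues_nonempty hH
  -- Each entry of a nonnegative `q` is at most its total. Capping the entries at the value of `q₀`
  -- makes the feasible region compact and loses only solutions no better than `q₀`.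
  let K : Set (I.IndepOfHeight H → ℝ) :=
    Set.Icc 0 (fun _ => 1 ⬝ᵥ q₀) ∩ {q | I.indepMatrix H *ᵥ q = 1}
  have hle : ∀ q : I.IndepOfHeight H → ℝ, 0 ≤ q → ∀ S, q S ≤ 1 ⬝ᵥ q := by
    intro q hq S
    rw [one_dotProduct]
    exact Finset.single_le_sum (fun S _ => hq S) (Finset.mem_univ S)
  have hK : IsCompact K :=
    isCompact_Icc.inter_right (isClosed_eq (by fun_prop) continuous_const)
  have hcont : Continuous fun q : I.IndepOfHeight H → ℝ => (1 : I.IndepOfHeight H → ℝ) ⬝ᵥ q := by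
    simp only [dotProduct]
    fun_prop
  have hmem : q₀ ∈ K := ⟨⟨hq₀0, hle q₀ hq₀0⟩, hq₀⟩
  obtain ⟨q, hqK, hmin⟩ := hK.exists_isMinOn ⟨q₀, hmem⟩ hcont.continuousOn
  refine ⟨1 ⬝ᵥ q, ⟨q, hqK.2, hqK.1.1, rfl⟩, ?_⟩
  rintro _ ⟨r, hr, hr0, rfl⟩
  rcases le_total (1 ⬝ᵥ r) (1 ⬝ᵥ q₀) with h | h
  · exact hmin (show r ∈ K from ⟨⟨hr0, fun S => (hle r hr0 S).trans h⟩, hr⟩)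
  · exact (hmin hmem).trans h

end Laminar

end IntervalRep

/-- Both linear programs have an optimal solution, and their optimal values are equal. -/
theorem mainTheorem5 {V : Type*} [Fintype V] (G : SimpleGraph V) (I : IntervalRep G)
    (H : ℕ) (hH : 1 ≤ H) :
    ∃ v : ℝ, IsLeast (I.cgRelaxationValues H) v ∧ IsLeast (I.pRelaxationValues H) v := by
  obtain ⟨v, hv⟩ := I.exists_isLeast_pRelaxationValues hH
  exact ⟨v, by rwa [I.cgRelaxationValues_eq H], hv⟩
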